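/- Consider a hybrid inclusion $\mathcal H=(C,F,D,G)$ on $\mathbb R^n$: $\dot x\in F(x)$ when $x\in C$, and $x^+\in G(x)$ when $x\in D$. Here $C,D\subset\mathbb R^n$ and $F,G:\mathbb R^n\rightrightarrows\mathbb R^n$. Assume that $F$ is outer semicontinuous and locally bounded on $C$ (relative to $C$) with nonempty convex values there, and that $G(x)\neq\emptyset$ for $x\in D$. A hybrid time domain is a nonempty set $E\subset\mathbb R_{\ge0}\times\mathbb N$ such that for each $(T,J)\in E$ there are $0=t_0\le t_1\le\dots\le t_{J+1}$ with $E\cap([0,T]\times\{0,\dots,J\})=\bigcup_{j=0}^J[t_j,t_{j+1}]\times\{j\}$. A solution to $\mathcal H$ is a function $x$ on a hybrid time domain $\operatorname{dom}x$ such that $t\mapsto x(t,j)$ is locally absolutely continuous on $I^j=\{t:(t,j)\in\operatorname{dom}x\}$ for each $j$, and: $x(0,0)\in\operatorname{cl}(C)\cup D$; whenever $I^j$ has nonempty interior, $x(t,j)\in C$ for all $t\in\operatorname{int}I^j$ and $\dot x(t,j)\in F(x(t,j))$ for almost every $t\in I^j$; and $x(t,j)\in D$, $x(t,j+1)\in G(x(t,j))$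 whenever $(t,j),(t,j+1)\in\operatorname{dom}x$. It is maximal if no solution on a strictly larger domain extends it, and nontrivial if $\operatorname{dom}x$ has at least two points. A closed set $K\subset C\cup D$ is pre-contractive if (i) every maximal solution $x$ with $x(0,0)\in K$ satisfies $x(t,j)\in K$ for all $(t,j)\in\operatorname{dom}x$, and (ii) for every nontrivial solution $x$ with $x(0,0)\in\partial K$ there are $T>0$ and $J\in\{1,2,\dots,\infty\}$ such that $x(t,j)\in\operatorname{int}(K)$ for all $(t,j)\in\operatorname{dom}x\cap\big[([0,T]\times\{0\})\cup(\{0\}\times\{0,1,\dots,J\})\big]$ with $(t,j)\ne(0,0)$. For $S\subset\mathbb R^n$, let $T_S(x)=\{v\in\mathbb R^n:\liminf_{h\to0^+}|x+hv|_S/h=0\}$ be the contingent cone, where $|y|_S$ is the distance from $y$ to $S$. **Theorem.** Let $B=(B_1,\dots,B_m):\mathbb R^n\to\mathbb R^m$ be $\mathcal C^1$ and suppose that $K=\{x\in C\cup D: B_i(x)\le0\text{ for all }i\}$ is closed and that $\partial K\cap\partial C\subset C$ (which holds in particular if $C$ is closed). Put $M_i=\{x\in\partial K:B_i(x)=0\}$.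 Then $K$ is pre-contractive if 1. $\langle\nabla B_i(x),\eta\rangle<0$ for every $i\in\{1,\dots,m\}$, every $x\in M_i\cap C$ and every $\eta\in F(x)\cap T_C(x)$; 2. $F(x)\cap T_{\partial C\cap\partial K}(x)=\emptyset$ for every $x\in\partial K\cap\partial C$; 3. $B_i(\eta)<0$ for every $i\in\{1,\dots,m\}$, every $x\in K\cap D$ and every $\eta\in G(x)$; 4. $G(x)\subset C\cup D$ for every $x\in K\cap D$; 5. $G(x)\subset\operatorname{int}(C\cup D)$ for every $x\in\partial K\cap D$. -/

import Mathlib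

open Set Filter Topology MeasureTheory
open scoped ENNReal

namespace HybridInclusion

/-- The data `(C, F, D, G)` of a hybrid inclusion on `ℝⁿ`. -/
structure HybridSystem (n : ℕ) where
  /-- flow set -/
  C : Set (EuclideanSpace ℝ (Fin n))
  /-- flow map -/
  F : EuclideanSpace ℝ (Fin n) → Set (EuclideanSpace ℝ (Fin n))
  /-- jump set -/
  D : Set (EuclideanSpace ℝ (Fin n))
  /-- jump map -/
  G : EuclideanSpace ℝ (Fin n) → Set (EuclideanSpace ℝ (Fin n))

/-- Outer semicontinuity of a set-valued map on (relative to) a set `O`. -/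
def OuterSemicontinuousOn {n : ℕ}
    (F : EuclideanSpace ℝ (Fin n) → Set (EuclideanSpace ℝ (Fin n)))
    (O : Set (EuclideanSpace ℝ (Fin n))) : Prop :=
  ∀ x ∈ O, ∀ (u v : ℕ → EuclideanSpace ℝ (Fin n)) (y : EuclideanSpace ℝ (Fin n)),
    (∀ k, u k ∈ O) → (∀ k, v k ∈ F (u k)) →
    Tendsto u atTop (𝓝 x) → Tendsto v atTop (𝓝 y) → y ∈ F x

/-- Local boundedness of a set-valued map on (relative to) a set `O`. -/
def LocallyBoundedOn {n : ℕ}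
    (F : EuclideanSpace ℝ (Fin n) → Set (EuclideanSpace ℝ (Fin n)))
    (O : Set (EuclideanSpace ℝ (Fin n))) : Prop :=
  ∀ x ∈ O, ∃ U ∈ 𝓝 x, ∃ R : ℝ, 0 < R ∧ ∀ y ∈ U ∩ O, ∀ ζ ∈ F y, ‖ζ‖ ≤ R

/-- The assumptions on the data of the hybrid inclusion: on `C`, the flow map is outer
semicontinuous and locally bounded with nonempty convex images, and the jump map has nonempty
images on `D`. -/
structure HybridSystem.StandingAssumption {n : ℕ} (H : HybridSystem n) : Prop where
  osc : OuterSemicontinuousOn H.F H.C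
  locallyBounded : LocallyBoundedOn H.F H.C
  nonempty_flow : ∀ x ∈ H.C, (H.F x).Nonempty
  convex_flow : ∀ x ∈ H.C, Convex ℝ (H.F x)
  nonempty_jump : ∀ x ∈ H.D, (H.G x).Nonempty

/-- Hybrid time domains: nonempty subsets `E` of `ℝ≥0 × ℕ` such that, for each `(T, J) ∈ E`, the
truncation `E ∩ ([0, T] × {0, …, J})` is `⋃_{j ≤ J} [t_j, t_{j+1}] × {j}` for some
`0 = t_0 ≤ t_1 ≤ … ≤ t_{J+1}`. -/
def IsHybridTimeDomain (E : Set (ℝ × ℕ)) : Prop :=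
  E.Nonempty ∧ (∀ p ∈ E, 0 ≤ p.1) ∧
  ∀ T : ℝ, ∀ J : ℕ, (T, J) ∈ E →
    ∃ t : ℕ → ℝ, t 0 = 0 ∧ (∀ j ≤ J, t j ≤ t (j + 1)) ∧
      E ∩ (Icc 0 T ×ˢ Iic J) = {p : ℝ × ℕ | p.2 ≤ J ∧ p.1 ∈ Icc (t p.2) (t (p.2 + 1))}

/-- A function of hybrid time: a domain together with a function of `(t, j)`, of which only the
values at the points of the domain matter. -/
structure HybridFunction (n : ℕ) where
  dom : Set (ℝ × ℕ)
  val : ℝ → ℕ → EuclideanSpace ℝ (Fin n)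

/-- The interval `I^j = {t | (t, j) ∈ dom x}`. -/
def HybridFunction.I {n : ℕ} (x : HybridFunction n) (j : ℕ) : Set ℝ :=
  {t | (t, j) ∈ x.dom}

/-- Solutions to a hybrid inclusion. -/
structure HybridSystem.IsSolution {n : ℕ} (H : HybridSystem n) (x : HybridFunction n) : Prop where
  isHybridTimeDomain : IsHybridTimeDomain x.dom
  /-- absolute continuity of `t ↦ x(t, j)` on the compact intervals contained in `I^j` -/
  absolutelyContinuous : ∀ j : ℕ, ∀ a b : ℝ, a ≤ b → Icc a b ⊆ x.I j →
    AbsolutelyContinuousOnInterval (fun t => x.val t j) a b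
  initial : x.val 0 0 ∈ closure H.C ∪ H.D
  flow_mem : ∀ j : ℕ, (interior (x.I j)).Nonempty → ∀ t ∈ interior (x.I j), x.val t j ∈ H.C
  flow_deriv : ∀ j : ℕ, (interior (x.I j)).Nonempty →
    ∀ᵐ t ∂(volume.restrict (x.I j)),
      ∃ v ∈ H.F (x.val t j), HasDerivWithinAt (fun s => x.val s j) v (x.I j) t
  jump : ∀ t : ℝ, ∀ j : ℕ, (t, j) ∈ x.dom → (t, j + 1) ∈ x.dom →
    x.val t j ∈ H.D ∧ x.val t (j + 1) ∈ H.G (x.val t j)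

/-- A solution is maximal if no solution extends it to a strictly larger domain. -/
def HybridSystem.IsMaximalSolution {n : ℕ} (H : HybridSystem n) (x : HybridFunction n) : Prop :=
  H.IsSolution x ∧
    ¬ ∃ y : HybridFunction n, H.IsSolution y ∧ x.dom ⊂ y.dom ∧
      ∀ t j, (t, j) ∈ x.dom → x.val t j = y.val t j

/-- Forward pre-invariance of a set. -/
def HybridSystem.ForwardPreInvariant {n : ℕ} (H : HybridSystem n)
    (K : Set (EuclideanSpace ℝ (Fin n))) : Prop :=
  ∀ x : HybridFunction n, H.IsMaximalSolution x → x.val 0 0 ∈ K →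
    ∀ t j, (t, j) ∈ x.dom → x.val t j ∈ K

/-- Pre-contractivity of a (closed) set `K ⊆ C ∪ D`: it is forward pre-invariant, and every
nontrivial solution from its boundary immediately enters its interior, by flow or by jump. -/
def HybridSystem.PreContractive {n : ℕ} (H : HybridSystem n)
    (K : Set (EuclideanSpace ℝ (Fin n))) : Prop :=
  IsClosed K ∧ K ⊆ H.C ∪ H.D ∧ H.ForwardPreInvariant K ∧
  ∀ x : HybridFunction n, H.IsSolution x → x.dom.Nontrivial → x.val 0 0 ∈ frontier K →
    ∃ T : ℝ, 0 < T ∧ ∃ J : ℕ∞, 1 ≤ J ∧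
      ∀ t j, (t, j) ∈ x.dom → (t, j) ≠ (0, 0) →
        ((t ∈ Icc 0 T ∧ j = 0) ∨ (t = 0 ∧ (j : ℕ∞) ≤ J)) → x.val t j ∈ interior K

/-- The contingent cone `T_S(x) = {v | liminf_{h → 0⁺} |x + h v|_S / h = 0}`; the distance and
the quotient are taken in `[0, ∞]`. -/
def contingentCone {n : ℕ} (S : Set (EuclideanSpace ℝ (Fin n))) (x : EuclideanSpace ℝ (Fin n)) :
    Set (EuclideanSpace ℝ (Fin n)) :=
  {v | liminf (fun h : ℝ => Metric.infEDist (x + h • v) S / ENNReal.ofReal h) (𝓝[>] 0) = 0}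

/-- `B` is a barrier function candidate defining the set `K`. -/
def HybridSystem.IsBarrierCandidate {n m : ℕ} (H : HybridSystem n)
    (B : EuclideanSpace ℝ (Fin n) → EuclideanSpace ℝ (Fin m))
    (K : Set (EuclideanSpace ℝ (Fin n))) : Prop :=
  K = {x | x ∈ H.C ∪ H.D ∧ ∀ i, B x i ≤ 0}

/-- `M_i = {x ∈ ∂K | B_i(x) = 0}`. -/
def boundaryPiece {n m : ℕ} (B : EuclideanSpace ℝ (Fin n) → EuclideanSpace ℝ (Fin m))
    (K : Set (EuclideanSpace ℝ (Fin n))) (i : Fin m) : Set (EuclideanSpace ℝ (Fin n)) :=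
  {x | x ∈ frontier K ∧ B x i = 0}

end HybridInclusion

namespace HybridInclusion

/-! ### Mean value estimates for absolutely continuous arcs. -/

section AbsolutelyContinuous

variable {E : Type*} [NormedAddCommGroup E] [NormedSpace ℝ E]

/-! The crux is that a flow arc `φ` starting on the boundary of `K` enters the interior at once. Its
difference quotients at the initial time are bounded, and all their limits `η` lie in `F (φ a)`
(`IsFlowArc.exists_tendsto_slope`). If the times used keep the arc in a set `S`, then `η` is also in
the contingent cone of `S` (`mem_contingentCone_of_tendsto`).

This is used twice. If an active `B_i` were nonnegative at arbitrarily small times, some `η` in the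
cone of `C` would satisfy `⟨∇B_i, η⟩ ≥ 0`, against `hflow`; so every `B_i` becomes negative. If the
arc still missed the interior of `K` at arbitrarily small times, it would then lie in `∂C ∩ ∂K`,
giving an `η` excluded by `hboundary`.

Invariance along flows follows by continuous induction, since `K` is closed. Jumps are controlled by
the last three hypotheses, and induction on the number of jumps combines the two. -/

theorem absolutelyContinuousOnInterval_clm_comp {φ : ℝ → E} {a b : ℝ}
    (hφ : AbsolutelyContinuousOnInterval φ a b) (L : E →L[ℝ] ℝ) :
    AbsolutelyContinuousOnInterval (fun t => L (φ t)) a b := by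
  apply squeeze_zero (fun t ↦ ?_) (fun t ↦ ?_) (by simpa using Tendsto.const_mul ‖L‖ hφ)
  · exact Finset.sum_nonneg (fun i _ ↦ dist_nonneg)
  · rw [Finset.mul_sum]
    exact Finset.sum_le_sum fun i _ ↦ L.lipschitz.dist_le_mul _ _

/-- A mean value inequality for absolutely continuous functions. -/
theorem clm_image_sub_le_of_ae_deriv {φ : ℝ → E} {a b : ℝ} (hab : a ≤ b)
    (hφ : AbsolutelyContinuousOnInterval φ a b) (L : E →L[ℝ] ℝ) (c : ℝ)
    (hderiv : ∀ᵐ s ∂(volume.restrict (Ioo a b)), ∃ v, L v ≤ c ∧ HasDerivAt φ v s) :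
    L (φ b - φ a) ≤ c * (b - a) := by
  have hL := absolutelyContinuousOnInterval_clm_comp hφ L
  rw [map_sub, ← hL.integral_deriv_eq_sub]
  calc ∫ s in a..b, deriv (fun t => L (φ t)) s ≤ ∫ _ in a..b, c := by
        refine intervalIntegral.integral_mono_ae_restrict hab hL.intervalIntegrable_deriv
          intervalIntegrable_const ?_
        rw [← restrict_Ioo_eq_restrict_Icc]
        filter_upwards [hderiv] with s ⟨v, hv, hs⟩
        exact (L.hasFDerivAt.comp_hasDerivAt s hs).deriv.trans_le hv
    _ = c * (b - a) := by simp [mul_comm]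

/-- A norming functional for the increment reduces this to the scalar estimate. -/
theorem norm_image_sub_le_of_ae_deriv {φ : ℝ → E} {a b : ℝ} (hab : a ≤ b)
    (hφ : AbsolutelyContinuousOnInterval φ a b) (R : ℝ)
    (hderiv : ∀ᵐ s ∂(volume.restrict (Ioo a b)), ∃ v, ‖v‖ ≤ R ∧ HasDerivAt φ v s) :
    ‖φ b - φ a‖ ≤ R * (b - a) := by
  obtain ⟨L, hL, hLx⟩ := exists_dual_vector'' ℝ (φ b - φ a)
  have := clm_image_sub_le_of_ae_deriv hab hφ L R (hderiv.mono fun s ⟨v, hv, hs⟩ =>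
    ⟨v, (le_abs_self _).trans ((L.le_opNorm v).trans
      ((mul_le_of_le_one_left (norm_nonneg v) hL).trans hv)), hs⟩)
  rw [hLx] at this
  exact this

end AbsolutelyContinuous

/-! ### Flow arcs and their initial difference quotients. -/

section Flow

variable {n : ℕ} {F : EuclideanSpace ℝ (Fin n) → Set (EuclideanSpace ℝ (Fin n))}
  {C : Set (EuclideanSpace ℝ (Fin n))} {φ : ℝ → EuclideanSpace ℝ (Fin n)} {a b : ℝ}

/-- An absolutely continuous arc on `[a, b]` that flows according to `F` inside `C`. -/
structure IsFlowArc (F : EuclideanSpace ℝ (Fin n) → Set (EuclideanSpace ℝ (Fin n)))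
    (C : Set (EuclideanSpace ℝ (Fin n))) (φ : ℝ → EuclideanSpace ℝ (Fin n)) (a b : ℝ) :
    Prop where
  lt : a < b
  absolutelyContinuous : AbsolutelyContinuousOnInterval φ a b
  mem : ∀ t ∈ Ioo a b, φ t ∈ C
  deriv : ∀ᵐ t ∂(volume.restrict (Ioo a b)), ∃ v ∈ F (φ t), HasDerivAt φ v t

theorem IsFlowArc.mono (h : IsFlowArc F C φ a b) {s t : ℝ} (has : a ≤ s) (hst : s < t)
    (htb : t ≤ b) : IsFlowArc F C φ s t where
  lt := hst
  absolutelyContinuous := h.absolutelyContinuous.mono (by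
    rw [uIcc_of_le hst.le, uIcc_of_le h.lt.le]
    exact Icc_subset_Icc has htb)
  mem r hr := h.mem r (Ioo_subset_Ioo has htb hr)
  deriv := ae_mono (Measure.restrict_mono (Ioo_subset_Ioo has htb) le_rfl) h.deriv

theorem IsFlowArc.continuousOn (h : IsFlowArc F C φ a b) : ContinuousOn φ (Icc a b) := by
  have := h.absolutelyContinuous.continuousOn
  rwa [uIcc_of_le h.lt.le] at this

theorem IsFlowArc.tendsto (h : IsFlowArc F C φ a b) : Tendsto φ (𝓝[>] a) (𝓝 (φ a)) := by
  have := h.continuousOn a (left_mem_Icc.2 h.lt.le)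
  refine this.mono_left ?_
  rw [nhdsWithin_Icc_eq_nhdsGE h.lt]
  exact nhdsWithin_mono _ Ioi_subset_Ici_self

theorem IsFlowArc.eventually_mem (h : IsFlowArc F C φ a b) : ∀ᶠ t in 𝓝[>] a, φ t ∈ C :=
  mem_of_superset (Ioo_mem_nhdsGT h.lt) h.mem

theorem IsFlowArc.mem_closure (h : IsFlowArc F C φ a b) : φ a ∈ closure C :=
  mem_closure_of_tendsto h.tendsto h.eventually_mem

/-- Puts bounds on the velocities of `F` near `φ a` into the form that the mean value estimates
require. -/
theorem IsFlowArc.eventually_ae_deriv (h : IsFlowArc F C φ a b)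
    {P : EuclideanSpace ℝ (Fin n) → Prop} (hP : ∀ᶠ y in 𝓝[C] (φ a), ∀ v ∈ F y, P v) :
    ∀ᶠ t in 𝓝[>] a, t ≤ b ∧
      ∀ᵐ s ∂(volume.restrict (Ioo a t)), ∃ v, P v ∧ HasDerivAt φ v s := by
  have hev : ∀ᶠ t in 𝓝[>] a, ∀ v ∈ F (φ t), P v :=
    (tendsto_nhdsWithin_iff.2 ⟨h.tendsto, h.eventually_mem⟩).eventually hP
  obtain ⟨δ, hδ, hsub⟩ := (mem_nhdsGT_iff_exists_Ioo_subset).1 hev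
  filter_upwards [Ioo_mem_nhdsGT hδ, Ioo_mem_nhdsGT h.lt] with t ht htb
  refine ⟨htb.2.le, ?_⟩
  filter_upwards [(h.mono le_rfl htb.1 htb.2.le).deriv, ae_restrict_mem measurableSet_Ioo]
    with s ⟨v, hv, hs⟩ hst
  exact ⟨v, hsub ⟨hst.1, hst.2.trans ht.2⟩ v hv, hs⟩

theorem LocallyBoundedOn.eventually_norm_le (hF : LocallyBoundedOn F C)
    {x : EuclideanSpace ℝ (Fin n)} (hx : x ∈ C) :
    ∃ R : ℝ, ∀ᶠ y in 𝓝[C] x, ∀ v ∈ F y, ‖v‖ ≤ R := by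
  obtain ⟨U, hU, R, -, hR⟩ := hF x hx
  exact ⟨R, by
    filter_upwards [mem_nhdsWithin_of_mem_nhds hU, self_mem_nhdsWithin] with y hyU hyC
    exact hR y ⟨hyU, hyC⟩⟩

theorem OuterSemicontinuousOn.isClosed (hF : OuterSemicontinuousOn F C)
    {x : EuclideanSpace ℝ (Fin n)} (hx : x ∈ C) : IsClosed (F x) := by
  refine IsSeqClosed.isClosed fun v y hv hy => ?_
  exact hF x hx (fun _ => x) v y (fun _ => hx) hv tendsto_const_nhds hy

/-- Upper semicontinuity with respect to open half-spaces. -/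
theorem OuterSemicontinuousOn.eventually_clm_lt (hF : OuterSemicontinuousOn F C)
    (hb : LocallyBoundedOn F C) {x : EuclideanSpace ℝ (Fin n)} (hx : x ∈ C)
    (L : EuclideanSpace ℝ (Fin n) →L[ℝ] ℝ) {c : ℝ} (hc : ∀ v ∈ F x, L v < c) :
    ∀ᶠ y in 𝓝[C] x, ∀ v ∈ F y, L v < c := by
  obtain ⟨R, hR⟩ := hb.eventually_norm_le hx
  by_contra hcon
  have hfreq : ∃ᶠ y in 𝓝[C] x, ∃ v ∈ F y, c ≤ L v := by
    refine (not_eventually.1 hcon).mono fun y hy => ?_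
    push Not at hy
    exact hy
  have hfreq' := hfreq.and_eventually (hR.and self_mem_nhdsWithin)
  obtain ⟨u, hu, hP⟩ := exists_seq_forall_of_frequently hfreq'
  -- Local boundedness yields a cluster point of these velocities, outer semicontinuity puts it in
  -- `F x`, and the closed condition `c ≤ L v` survives in the limit.
  choose v hv hvc using fun k => (hP k).1
  have hvR : ∀ k, v k ∈ Metric.closedBall (0 : EuclideanSpace ℝ (Fin n)) R := fun k => by
    simpa using (hP k).2.1 _ (hv k)
  obtain ⟨y, -, ψ, hψ, hy⟩ := tendsto_subseq_of_bounded Metric.isBounded_closedBall hvR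
  have hyF : y ∈ F x := hF x hx (u ∘ ψ) (v ∘ ψ) y (fun k => (hP _).2.2) (fun k => hv _)
    ((hu.mono_right nhdsWithin_le_nhds).comp hψ.tendsto_atTop) hy
  refine (hc y hyF).not_ge (ge_of_tendsto ((L.continuous.tendsto y).comp hy) ?_)
  exact Eventually.of_forall fun k => hvc _

/-- Limits of difference quotients of a flow arc at its initial point exist along subsequences and
belong to the flow map. -/
theorem IsFlowArc.exists_tendsto_slope (h : IsFlowArc F C φ a b)
    (hF : OuterSemicontinuousOn F C) (hb : LocallyBoundedOn F C)
    (hconv : ∀ x ∈ C, Convex ℝ (F x)) (hφ : φ a ∈ C) {P : ℝ → Prop}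
    (hP : ∃ᶠ t in 𝓝[>] a, P t) :
    ∃ η ∈ F (φ a), ∃ u : ℕ → ℝ, Tendsto u atTop (𝓝[>] a) ∧ (∀ k, P (u k)) ∧
      Tendsto (fun k => (u k - a)⁻¹ • (φ (u k) - φ a)) atTop (𝓝 η) := by
  obtain ⟨R, hR⟩ := hb.eventually_norm_le hφ
  have hbound : ∀ᶠ t in 𝓝[>] a, ‖(t - a)⁻¹ • (φ t - φ a)‖ ≤ R := by
    filter_upwards [h.eventually_ae_deriv hR, self_mem_nhdsWithin] with t ⟨htb, ht⟩ hat
    have hpos : 0 < t - a := sub_pos.2 hat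
    have := norm_image_sub_le_of_ae_deriv (le_of_lt hat)
      (h.mono le_rfl hat htb).absolutelyContinuous R ht
    rw [norm_smul, norm_inv, Real.norm_of_nonneg hpos.le, inv_mul_le_iff₀ hpos, mul_comm]
    exact this
  obtain ⟨w, hw, hwP⟩ := exists_seq_forall_of_frequently (hP.and_eventually hbound)
  obtain ⟨η, -, ψ, hψ, hη⟩ := tendsto_subseq_of_bounded
    (Metric.isBounded_closedBall (x := (0 : EuclideanSpace ℝ (Fin n))) (r := R))
    (x := fun k => (w k - a)⁻¹ • (φ (w k) - φ a)) (fun k => by simpa using (hwP k).2)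
  have hwψ : Tendsto (w ∘ ψ) atTop (𝓝[>] a) := hw.comp hψ.tendsto_atTop
  refine ⟨η, ?_, w ∘ ψ, hwψ, fun k => (hwP _).1, hη⟩
  -- Separate `η` strictly from the closed convex set `F (φ a)`. The half-space `L < c` contains all
  -- nearby velocities, so the mean value estimate forces `L η ≤ c`.
  by_contra hmem
  obtain ⟨L, c, hLc, hLη⟩ := geometric_hahn_banach_closed_point (hconv _ hφ) (hF.isClosed hφ) hmem
  refine hLη.not_ge (le_of_tendsto ((L.continuous.tendsto η).comp hη) ?_)
  filter_upwards [hwψ.eventually (h.eventually_ae_deriv (hF.eventually_clm_lt hb hφ L hLc)),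
    hwψ.eventually self_mem_nhdsWithin] with k ⟨hkb, hk⟩ hak
  have hpos : 0 < (w ∘ ψ) k - a := sub_pos.2 hak
  have := clm_image_sub_le_of_ae_deriv (le_of_lt hak)
    (h.mono le_rfl hak hkb).absolutelyContinuous L c
    (hk.mono fun s ⟨v, hv, hs⟩ => ⟨v, hv.le, hs⟩)
  simp only [Function.comp_apply, map_smul, smul_eq_mul] at this hpos ⊢
  rwa [inv_mul_le_iff₀ hpos, mul_comm]

/-- The point `φ (u k)` of `S` is within `h * ‖η - quotient‖` of `φ a + h • η`, where `h = u k - a`;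
a `liminf` only needs smallness along one sequence. -/
theorem mem_contingentCone_of_tendsto {S : Set (EuclideanSpace ℝ (Fin n))}
    {η : EuclideanSpace ℝ (Fin n)} {u : ℕ → ℝ} (hu : Tendsto u atTop (𝓝[>] a))
    (hS : ∀ k, φ (u k) ∈ S)
    (hη : Tendsto (fun k => (u k - a)⁻¹ • (φ (u k) - φ a)) atTop (𝓝 η)) :
    η ∈ contingentCone S (φ a) := by
  have hu' : Tendsto (fun k => u k - a) atTop (𝓝[>] 0) := by
    rw [tendsto_nhdsWithin_iff] at hu ⊢
    refine ⟨?_, hu.2.mono fun k hk => mem_Ioi.2 (sub_pos.2 hk)⟩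
    simpa using hu.1.sub_const a
  change liminf _ _ = 0
  refine le_antisymm (le_of_forall_gt_imp_ge_of_dense fun ε hε => ?_) bot_le
  refine liminf_le_of_frequently_le' (hu'.frequently (Eventually.frequently ?_))
  have hdist : Tendsto (fun k => edist η ((u k - a)⁻¹ • (φ (u k) - φ a))) atTop (𝓝 0) := by
    simpa using (tendsto_const_nhds (x := η)).edist hη
  filter_upwards [hu'.eventually self_mem_nhdsWithin, hdist.eventually (gt_mem_nhds hε)]
    with k hk hlt
  have hk : 0 < u k - a := hk
  refine ENNReal.div_le_of_le_mul ?_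
  calc Metric.infEDist (φ a + (u k - a) • η) S
      ≤ edist (φ a + (u k - a) • η) (φ (u k)) := Metric.infEDist_le_edist_of_mem (hS k)
    _ = edist (φ a + (u k - a) • η)
          (φ a + (u k - a) • ((u k - a)⁻¹ • (φ (u k) - φ a))) := by
        rw [smul_inv_smul₀ hk.ne', add_sub_cancel]
    _ = ENNReal.ofReal (u k - a) * edist η ((u k - a)⁻¹ • (φ (u k) - φ a)) := by
        rw [edist_add_left, edist_smul₀, ENNReal.smul_def, smul_eq_mul]
        rw [← Real.enorm_of_nonneg hk.le, enorm_eq_nnnorm]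
    _ ≤ ε * ENNReal.ofReal (u k - a) := by
        rw [mul_comm]
        gcongr

theorem tendsto_slope_comp {g : EuclideanSpace ℝ (Fin n) → ℝ}
    (hg : DifferentiableAt ℝ g (φ a)) (hφ : Tendsto φ (𝓝[>] a) (𝓝 (φ a)))
    {η : EuclideanSpace ℝ (Fin n)} {u : ℕ → ℝ} (hu : Tendsto u atTop (𝓝[>] a))
    (hη : Tendsto (fun k => (u k - a)⁻¹ • (φ (u k) - φ a)) atTop (𝓝 η)) :
    Tendsto (fun k => (u k - a)⁻¹ * (g (φ (u k)) - g (φ a))) atTop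
      (𝓝 (inner ℝ (gradient g (φ a)) η)) := by
  have hd : Tendsto (fun k => φ (u k) - φ a) atTop (𝓝 0) := by
    simpa using (hφ.comp hu).sub_const (φ a)
  have := (hg.hasGradientAt.hasFDerivAt.hasFDerivWithinAt (s := univ)).lim hd
    (Eventually.of_forall fun _ => mem_univ _) hη
  simpa using this

end Flow

/-! ### Structure of hybrid time domains. -/

section TimeDomain

theorem IsHybridTimeDomain.zero_mem {E : Set (ℝ × ℕ)} (hE : IsHybridTimeDomain E) :
    ((0 : ℝ), 0) ∈ E := by
  obtain ⟨⟨⟨T, J⟩, hTJ⟩, -, h⟩ := hE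
  obtain ⟨t, ht0, hmono, heq⟩ := h T J hTJ
  have : ((0 : ℝ), 0) ∈ E ∩ (Icc 0 T ×ˢ Iic J) := by
    rw [heq]
    exact ⟨Nat.zero_le J, ht0.le, by simpa [ht0] using hmono 0 (Nat.zero_le J)⟩
  exact this.1

theorem IsHybridTimeDomain.Icc_subset {E : Set (ℝ × ℕ)} (hE : IsHybridTimeDomain E) {s T : ℝ}
    {j : ℕ} (hs : (s, j) ∈ E) (hT : (T, j) ∈ E) : Icc s T ⊆ {t | (t, j) ∈ E} := by
  intro r hr
  obtain ⟨t, -, -, heq⟩ := hE.2.2 T j hT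
  have hs0 : 0 ≤ s := hE.2.1 _ hs
  have hs' : (s, j) ∈ E ∩ (Icc 0 T ×ˢ Iic j) := ⟨hs, ⟨hs0, hr.1.trans hr.2⟩, le_refl j⟩
  have hT' : (T, j) ∈ E ∩ (Icc 0 T ×ˢ Iic j) :=
    ⟨hT, ⟨hs0.trans (hr.1.trans hr.2), le_rfl⟩, le_refl j⟩
  rw [heq] at hs' hT'
  have : (r, j) ∈ E ∩ (Icc 0 T ×ˢ Iic j) := by
    rw [heq]
    exact ⟨le_rfl, hs'.2.1.trans hr.1, hr.2.trans hT'.2.2⟩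
  exact this.1

theorem IsHybridTimeDomain.exists_jump {E : Set (ℝ × ℕ)} (hE : IsHybridTimeDomain E) {T : ℝ}
    {j : ℕ} (hT : (T, j + 1) ∈ E) : ∃ s ≤ T, (s, j) ∈ E ∧ (s, j + 1) ∈ E := by
  obtain ⟨t, -, hmono, heq⟩ := hE.2.2 T (j + 1) hT
  have hT' : (T, j + 1) ∈ E ∩ (Icc 0 T ×ˢ Iic (j + 1)) :=
    ⟨hT, ⟨hE.2.1 _ hT, le_rfl⟩, le_refl (j + 1)⟩
  rw [heq] at hT'
  -- The jump time is the endpoint shared by the intervals of index `j` and `j + 1`.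
  refine ⟨t (j + 1), hT'.2.1, ?_, ?_⟩
  · have : (t (j + 1), j) ∈ E ∩ (Icc 0 T ×ˢ Iic (j + 1)) := by
      rw [heq]
      exact ⟨Nat.le_succ j, hmono j (Nat.le_succ j), le_rfl⟩
    exact this.1
  · have : (t (j + 1), j + 1) ∈ E ∩ (Icc 0 T ×ˢ Iic (j + 1)) := by
      rw [heq]
      exact ⟨le_rfl, le_rfl, hmono (j + 1) le_rfl⟩
    exact this.1

end TimeDomain

/-! ### Entering the interior of `K`, and invariance along flows. -/

section Barrier

variable {n m : ℕ} {H : HybridSystem n}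
  {B : EuclideanSpace ℝ (Fin n) → EuclideanSpace ℝ (Fin m)} {K : Set (EuclideanSpace ℝ (Fin n))}

theorem HybridSystem.IsSolution.isFlowArc {x : HybridFunction n} (hx : H.IsSolution x) {j : ℕ}
    {s t : ℝ} (hst : s < t) (hs : (s, j) ∈ x.dom) (ht : (t, j) ∈ x.dom) :
    IsFlowArc H.F H.C (fun r => x.val r j) s t := by
  have hsub : Icc s t ⊆ x.I j := hx.isHybridTimeDomain.Icc_subset hs ht
  have hint : Ioo s t ⊆ interior (x.I j) :=
    interior_maximal (Ioo_subset_Icc_self.trans hsub) isOpen_Ioo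
  have hne : (interior (x.I j)).Nonempty := (nonempty_Ioo.2 hst).mono hint
  refine ⟨hst, hx.absolutelyContinuous j s t hst.le hsub,
    fun r hr => hx.flow_mem j hne r (hint hr), ?_⟩
  have hd := ae_mono (Measure.restrict_mono (Ioo_subset_Icc_self.trans hsub) le_rfl)
    (hx.flow_deriv j hne)
  filter_upwards [hd, ae_restrict_mem measurableSet_Ioo] with r ⟨v, hv, hr⟩ hrmem
  exact ⟨v, hv, hr.hasDerivAt (mem_interior_iff_mem_nhds.1 (hint hrmem))⟩

theorem HybridSystem.IsBarrierCandidate.mem_interior (hK : H.IsBarrierCandidate B K)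
    (hB : Continuous B) {y : EuclideanSpace ℝ (Fin n)} (hy : y ∈ interior (H.C ∪ H.D))
    (hneg : ∀ i, B y i < 0) : y ∈ interior K := by
  rw [mem_interior_iff_mem_nhds] at hy ⊢
  have hev : ∀ᶠ z in 𝓝 y, ∀ i, B z i < 0 := eventually_all.2 fun i =>
    (((EuclideanSpace.proj i : EuclideanSpace ℝ (Fin m) →L[ℝ] ℝ).continuous.comp
      hB).continuousAt (x := y)).eventually (gt_mem_nhds (hneg i))
  rw [hK]
  filter_upwards [hy, hev] with z hz hneg
  exact ⟨hz, fun i => (hneg i).le⟩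

/-- A flow arc issued from the boundary of `K` immediately enters the interior of `K`. -/
theorem IsFlowArc.eventually_mem_interior (hH : H.StandingAssumption) (hB : ContDiff ℝ 1 B)
    (hK : H.IsBarrierCandidate B K) (hKclosed : IsClosed K)
    (hKC : frontier K ∩ frontier H.C ⊆ H.C)
    (hflow : ∀ i : Fin m, ∀ x ∈ boundaryPiece B K i ∩ H.C,
      ∀ η ∈ H.F x ∩ contingentCone H.C x, inner ℝ (gradient (fun y => B y i) x) η < 0)
    (hboundary : ∀ x ∈ frontier K ∩ frontier H.C,
      H.F x ∩ contingentCone (frontier H.C ∩ frontier K) x = ∅)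
    {φ : ℝ → EuclideanSpace ℝ (Fin n)} {a b : ℝ} (h : IsFlowArc H.F H.C φ a b)
    (hφ : φ a ∈ frontier K) : ∀ᶠ t in 𝓝[>] a, φ t ∈ interior K := by
  -- As a limit of points of `C`, `φ a` could only be missing from `C` by lying on its frontier,
  -- where `hKC` applies.
  have hφC : φ a ∈ H.C := by
    by_contra hC
    exact hC (hKC ⟨hφ, h.mem_closure, fun hi => hC (interior_subset hi)⟩)
  have hφK : ∀ i, B (φ a) i ≤ 0 := by
    have := hKclosed.frontier_subset hφ
    rw [hK] at this
    exact this.2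
  have hBi : ∀ i, ContDiff ℝ 1 fun y => B y i := fun i =>
    (EuclideanSpace.proj i : EuclideanSpace ℝ (Fin m) →L[ℝ] ℝ).contDiff.comp hB
  have hneg : ∀ᶠ t in 𝓝[>] a, ∀ i, B (φ t) i < 0 := by
    refine eventually_all.2 fun i => ?_
    -- Inactive constraints stay negative by continuity; only active ones need `hflow`.
    rcases (hφK i).lt_or_eq with hlt | heq
    · exact (((hBi i).continuous.tendsto _).comp h.tendsto).eventually (gt_mem_nhds hlt)
    · by_contra hcon
      obtain ⟨η, hηF, u, hu, hP, hη⟩ := h.exists_tendsto_slope hH.osc hH.locallyBounded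
        hH.convex_flow hφC ((not_eventually.1 hcon).and_eventually h.eventually_mem)
      have hlt := hflow i (φ a) ⟨⟨hφ, heq⟩, hφC⟩ η
        ⟨hηF, mem_contingentCone_of_tendsto hu (fun k => (hP k).2) hη⟩
      refine hlt.not_ge (ge_of_tendsto (tendsto_slope_comp
        ((hBi i).differentiable one_ne_zero _) h.tendsto hu hη) ?_)
      filter_upwards [hu.eventually self_mem_nhdsWithin] with k hk
      have hpos : 0 < u k - a := sub_pos.2 hk
      have := not_lt.1 (hP k).1
      rw [heq, sub_zero]
      positivity
  by_contra hcon
  -- A point of `C` with all `B_i < 0` belongs to `K`, and to its interior if it is interior to `C`.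
  -- Missing the interior of `K` thus puts it on both frontiers.
  have hfreq : ∃ᶠ t in 𝓝[>] a, φ t ∈ frontier H.C ∩ frontier K := by
    refine ((not_eventually.1 hcon).and_eventually (h.eventually_mem.and hneg)).mono ?_
    rintro t ⟨hnot, hC, hlt⟩
    refine ⟨⟨subset_closure hC, fun hi => hnot (hK.mem_interior hB.continuous
      (interior_mono subset_union_left hi) hlt)⟩, subset_closure ?_, hnot⟩
    rw [hK]
    exact ⟨Or.inl hC, fun i => (hlt i).le⟩
  obtain ⟨η, hηF, u, hu, hP, hη⟩ := h.exists_tendsto_slope hH.osc hH.locallyBounded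
    hH.convex_flow hφC hfreq
  have hfr : φ a ∈ frontier H.C := isClosed_frontier.mem_of_tendsto (h.tendsto.comp hu)
    (Eventually.of_forall fun k => (hP k).1)
  have : η ∈ (∅ : Set (EuclideanSpace ℝ (Fin n))) := by
    rw [← hboundary (φ a) ⟨hφ, hfr⟩]
    exact ⟨hηF, mem_contingentCone_of_tendsto hu hP hη⟩
  exact this

/-- A flow arc cannot leave a closed set whose interior it enters from each boundary point. -/
theorem IsFlowArc.mem_of_eventually_mem_interior {F : EuclideanSpace ℝ (Fin n) → Set _}
    {C : Set (EuclideanSpace ℝ (Fin n))} {φ : ℝ → EuclideanSpace ℝ (Fin n)} {a b : ℝ}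
    (h : IsFlowArc F C φ a b) (hKclosed : IsClosed K) (ha : φ a ∈ K)
    (henter : ∀ s, IsFlowArc F C φ s b → φ s ∈ frontier K → ∀ᶠ t in 𝓝[>] s, φ t ∈ interior K) :
    ∀ t ∈ Icc a b, φ t ∈ K := by
  refine IsClosed.Icc_subset_of_forall_mem_nhdsWithin (s := φ ⁻¹' K) ?_ ha ?_
  · rw [inter_comm]
    exact h.continuousOn.preimage_isClosed_of_isClosed isClosed_Icc hKclosed
  · rintro s ⟨hsK, hs⟩
    have harc := h.mono hs.1 hs.2 le_rfl
    have hev : ∀ᶠ t in 𝓝[>] s, φ t ∈ interior K := by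
      by_cases hint : φ s ∈ interior K
      · exact harc.tendsto.eventually (isOpen_interior.mem_nhds hint)
      · exact henter s harc ⟨subset_closure hsK, hint⟩
    exact hev.mono fun t ht => interior_subset ht

end Barrier

end HybridInclusion

/-! ### Flows and jumps combined. -/

theorem theorem5 {n m : ℕ} (H : HybridInclusion.HybridSystem n) (hH : H.StandingAssumption)
    (B : EuclideanSpace ℝ (Fin n) → EuclideanSpace ℝ (Fin m)) (hB : ContDiff ℝ 1 B)
    (K : Set (EuclideanSpace ℝ (Fin n))) (hK : H.IsBarrierCandidate B K) (hKclosed : IsClosed K)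
    (hKC : frontier K ∩ frontier H.C ⊆ H.C)
    (hflow : ∀ i : Fin m, ∀ x ∈ HybridInclusion.boundaryPiece B K i ∩ H.C,
      ∀ η ∈ H.F x ∩ HybridInclusion.contingentCone H.C x,
        inner ℝ (gradient (fun y => B y i) x) η < 0)
    (hboundary : ∀ x ∈ frontier K ∩ frontier H.C,
      H.F x ∩ HybridInclusion.contingentCone (frontier H.C ∩ frontier K) x = ∅)
    (hjump : ∀ x ∈ K ∩ H.D, ∀ η ∈ H.G x, ∀ i : Fin m, B η i < 0)
    (hjumpMem : ∀ x ∈ K ∩ H.D, H.G x ⊆ H.C ∪ H.D)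
    (hjumpInt : ∀ x ∈ frontier K ∩ H.D, H.G x ⊆ interior (H.C ∪ H.D)) :
    H.PreContractive K := by
  have hint : ∀ {φ : ℝ → EuclideanSpace ℝ (Fin n)} {a b : ℝ},
      HybridInclusion.IsFlowArc H.F H.C φ a b → φ a ∈ frontier K →
      ∀ᶠ t in 𝓝[>] a, φ t ∈ interior K := fun h hφ =>
    h.eventually_mem_interior hH hB hK hKclosed hKC hflow hboundary hφ
  refine ⟨hKclosed, fun x hx => ?_, ?_, ?_⟩
  · rw [hK] at hx
    exact hx.1
  · intro x hx h0 t j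
    have hdom := hx.1.isHybridTimeDomain
    have hflowInv : ∀ {j : ℕ} {s t : ℝ}, s ≤ t → (s, j) ∈ x.dom → (t, j) ∈ x.dom →
        x.val s j ∈ K → x.val t j ∈ K := by
      intro j s t hst hs ht hsK
      rcases hst.eq_or_lt with rfl | hlt
      · exact hsK
      · exact (hx.1.isFlowArc hlt hs ht).mem_of_eventually_mem_interior hKclosed hsK
          (fun r harc hr => hint harc hr) t (right_mem_Icc.2 hst)
    induction j generalizing t with
    | zero => exact fun ht => hflowInv (hdom.2.1 _ ht) hdom.zero_mem ht h0
    | succ j ih =>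
      intro ht
      obtain ⟨s, hst, hs, hs'⟩ := hdom.exists_jump ht
      obtain ⟨hD, hG⟩ := hx.1.jump s j hs hs'
      have hsK : x.val s j ∈ K ∩ H.D := ⟨ih s hs, hD⟩
      refine hflowInv hst hs' ht ?_
      rw [hK]
      exact ⟨hjumpMem _ hsK hG, fun i => (hjump _ hsK _ hG i).le⟩
  · intro x hx _ h0
    have hdom := hx.isHybridTimeDomain
    have hT : ∃ T : ℝ, 0 < T ∧ ∀ t, (t, 0) ∈ x.dom → 0 < t → t ≤ T →
        x.val t 0 ∈ interior K := by
      by_cases hex : ∃ b, 0 < b ∧ (b, 0) ∈ x.dom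
      · obtain ⟨b, hb, hbdom⟩ := hex
        obtain ⟨δ, hδ, hsub⟩ := mem_nhdsGT_iff_exists_Ioc_subset.1
          (hint (hx.isFlowArc hb hdom.zero_mem hbdom) h0)
        exact ⟨δ, hδ, fun t _ ht0 htδ => hsub ⟨ht0, htδ⟩⟩
      -- Without an initial flow phase there is nothing to check, so any `T > 0` serves.
      · exact ⟨1, one_pos, fun t ht ht0 _ => (hex ⟨t, ht0, ht⟩).elim⟩
    obtain ⟨T, hTpos, hT⟩ := hT
    -- With `J = 1`, the only point to check at time `0` is the one reached by the first jump, which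
    -- `hjumpInt` and `hjump` place in the interior.
    refine ⟨T, hTpos, 1, le_rfl, fun t j htj hne hcase => ?_⟩
    have hpos : j = 0 → 0 < t := fun hj =>
      lt_of_le_of_ne (hdom.2.1 _ htj) fun h => hne (by rw [← h, hj])
    rcases hcase with ⟨ht, rfl⟩ | ⟨rfl, hj⟩
    · exact hT t htj (hpos rfl) ht.2
    · have hj1 : j ≤ 1 := by exact_mod_cast hj
      interval_cases j
      · exact absurd (hpos rfl) (lt_irrefl 0)
      · obtain ⟨hD, hG⟩ := hx.jump 0 0 hdom.zero_mem htj
        exact hK.mem_interior hB.continuous (hjumpInt _ ⟨h0, hD⟩ hG)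
          (hjump _ ⟨hKclosed.frontier_subset h0, hD⟩ _ hG)
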